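/- A \emph{modality} is a finite (possibly empty) sequence of the symbols $\Box$ and $\Diamond$; $MA$ denotes the modality $A$ prefixed with $M\in\{\Box,\Diamond\}$. Let $S5_{\Box\Diamond}$ be the category whose objects are the modalities and whose arrows are equivalence classes of arrow terms. Arrow terms are built from $$\mathbf 1_A\colon A\vdash A,\quad \varepsilon^\Box_A\colon \Box A\vdash A,\quad \varepsilon^\Diamond_A\colon A\vdash\Diamond A,\quad \delta^{\Box M}_A\colon MA\vdash\Box MA,\quad \delta^{\Diamond M}_A\colon\Diamond MA\vdash MA$$ (for all modalities $A$ and $M\in\{\Box,\Diamond\}$) by composition $g\circ f$ and by the operations taking $f\colon A\vdash B$ to $Mf\colon MA\vdash MB$. They are identified by the smallest equivalence relation (on terms of the same type) that is a congruence for these operations and satisfies, for all $M\in\{\Box,\Diamond\}$, all modalities $A,B$ and all arrow terms of suitable types with $f\colon A\vdash B$: - the category axioms, $M\mathbf 1_A=\mathbf 1_{MA}$ and $M(g\circ f)=Mg\circ Mf$; - naturality: $\varepsilon^\Box_B\circ\Box f=f\circ\varepsilon^\Box_A$, $\;\Diamond f\circ\varepsilon^\Diamond_A=\varepsilon^\Diamond_B\circ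 f$, $\;\Box Mf\circ\delta^{\Box M}_A=\delta^{\Box M}_B\circ Mf$, $\;\delta^{\Diamond M}_B\circ\Diamond Mf=Mf\circ\delta^{\Diamond M}_A$; - $\Box\delta^{\Box M}_A\circ\delta^{\Box M}_A=\delta^{\Box\Box}_{MA}\circ\delta^{\Box M}_A$ and $\delta^{\Diamond M}_A\circ\Diamond\delta^{\Diamond M}_A=\delta^{\Diamond M}_A\circ\delta^{\Diamond\Diamond}_{MA}$; - $\varepsilon^\Box_{MA}\circ\delta^{\Box M}_A=\mathbf 1_{MA}$ and $\delta^{\Diamond M}_A\circ\varepsilon^\Diamond_{MA}=\mathbf 1_{MA}$; - $\Box\varepsilon^\Box_A\circ\delta^{\Box\Box}_A=\mathbf 1_{\Box A}$ and $\delta^{\Diamond\Diamond}_A\circ\Diamond\varepsilon^\Diamond_A=\mathbf 1_{\Diamond A}$; - the Frobenius-like equations $\Box\delta^{\Diamond M}_A\circ\delta^{\Box\Diamond}_{MA}=\delta^{\Box M}_A\circ\delta^{\Diamond M}_A$ ($\delta$N) and $\delta^{\Diamond\Box}_{MA}\circ\Diamond\delta^{\Box M}_A=\delta^{\Box M}_A\circ\delta^{\Diamond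 M}_A$ ($\delta$I). Let $\mathrm{Gen}$ be the category whose objects are the finite ordinals $n=\{0,\dots,n-1\}$ and whose arrows from $n$ to $m$ are the equivalence relations on the disjoint union of $n$ (the source) and $m$ (the target), called split equivalences. The identity arrow links each $i$ in the source with $i$ in the target. The composite of arrows $n\to m$ and $m\to k$ is the transitive closure of their union, restricted to the disjoint union of $n$ and $k$. Let $G\colon S5_{\Box\Diamond}\to\mathrm{Gen}$ be the functor that sends a modality to its length and is determined on arrows as follows, where $n$ is the length of $A$ and all links not implied by those mentioned are absent: - $G\varepsilon^\Box_A\colon n+1\to n$ and $G\varepsilon^\Diamond_A\colon n\to n+1$ link $i$ in the source with $i$ in the target for $0\le i<n$, the remaining element $n$ being alone in its class; - $G\delta^{\Box M}_A\colon n+1\to n+2$ links $i$ in the source with $i$ in the target for $0\le i\le n$, and $n$ with $n+1$ in the target (a cap); - $G\delta^{\Diamond M}_A\colon n+2\to n+1$ links $i$ in the source with $i$ in the target for $0\le i\le n$, and $n$ with $n+1$ in the source (a cup); - for $f\colon A\vdash B$ with $Gf\colon n\to m$, the partition of $G(Mf)\colon n+1\to m+1$ is that of $Gf$ with the additional class consisting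 of $n$ in the source and $m$ in the target. Then the functor $G$ is faithful: if $f,g\colon A\vdash B$ are arrows of $S5_{\Box\Diamond}$ with $Gf=Gg$, then $f=g$. -/

import Mathlib

open CategoryTheory

/-! ### Split equivalences between finite ordinals -/

namespace SplitEquiv

variable {X Y Z W : Type}

/-- The union of a relation on `X ⊕ Y` and a relation on `Y ⊕ Z`, seen as a relation on
`X ⊕ Y ⊕ Z`. -/
inductive Union (R : Setoid (X ⊕ Y)) (S : Setoid (Y ⊕ Z)) : X ⊕ Y ⊕ Z → X ⊕ Y ⊕ Z → Prop
  | left {a b : X ⊕ Y} (h : R a b) : Union R S (Sum.map id Sum.inl a) (Sum.map id Sum.inl b)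
  | right {a b : Y ⊕ Z} (h : S a b) : Union R S (Sum.inr a) (Sum.inr b)

/-- Composition of split equivalences: the equivalence relation generated by the union (that is,
its transitive closure, the union being reflexive and symmetric), restricted to source and target.
The order of the arguments is diagrammatic. -/
def comp (R : Setoid (X ⊕ Y)) (S : Setoid (Y ⊕ Z)) : Setoid (X ⊕ Z) :=
  (Relation.EqvGen.setoid (Union R S)).comap (Sum.map id Sum.inr)

/-- The identity split equivalence: every element of the source is related to its copy in the
target. -/
def one (X : Type) : Setoid (X ⊕ X) := Setoid.ker (Sum.elim id id)

/-- A labelling of source and target by propositions is compatible with a split equivalence if it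
is constant on its classes. (Auxiliary, for checking the laws below.) -/
def Compat (R : Setoid (X ⊕ Y)) (α : X → Prop) (β : Y → Prop) : Prop :=
  ∀ a b, R a b → Sum.elim α β a = Sum.elim α β b

theorem ext_compat {R S : Setoid (X ⊕ Y)} (h : ∀ α β, Compat R α β ↔ Compat S α β) : R = S := by
  have key : ∀ {R S : Setoid (X ⊕ Y)}, (∀ α β, Compat R α β → Compat S α β) →
      ∀ a b, S a b → R a b := by
    intro R S h a b hab
    have h1 := h (fun x => R a (Sum.inl x)) (fun y => R a (Sum.inr y)) (by
      intro p q hpq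
      have : ∀ p, Sum.elim (fun x => R a (Sum.inl x)) (fun y => R a (Sum.inr y)) p = R a p := by
        rintro (p | p) <;> rfl
      rw [this, this]
      exact propext ⟨fun k => R.trans' k hpq, fun k => R.trans' k (R.symm' hpq)⟩) a b hab
    have : ∀ p, Sum.elim (fun x => R a (Sum.inl x)) (fun y => R a (Sum.inr y)) p = R a p := by
      rintro (p | p) <;> rfl
    rw [this, this] at h1
    exact h1 ▸ R.refl' a
  ext a b
  exact ⟨key (fun α β => (h α β).2) a b, key (fun α β => (h α β).1) a b⟩

theorem compat_comp {R : Setoid (X ⊕ Y)} {S : Setoid (Y ⊕ Z)} {α : X → Prop} {γ : Z → Prop} :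
    Compat (comp R S) α γ ↔ ∃ β, Compat R α β ∧ Compat S β γ := by
  constructor
  · intro h
    let E := Relation.EqvGen.setoid (Union R S)
    let L : X ⊕ Y ⊕ Z → Prop := fun p =>
      ∃ a : X ⊕ Z, Sum.elim α γ a ∧ E (Sum.map id Sum.inr a) p
    have hL : ∀ p q, E p q → L p = L q := fun p q hpq => propext
      ⟨fun ⟨a, ha, hap⟩ => ⟨a, ha, E.trans' hap hpq⟩,
        fun ⟨a, ha, haq⟩ => ⟨a, ha, E.trans' haq (E.symm' hpq)⟩⟩
    have hL' : ∀ a : X ⊕ Z, L (Sum.map id Sum.inr a) = Sum.elim α γ a := fun a => propext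
      ⟨fun ⟨b, hb, hba⟩ => (h b a hba) ▸ hb, fun ha => ⟨a, ha, E.refl' _⟩⟩
    refine ⟨fun y => L (Sum.inr (Sum.inl y)), ?_, ?_⟩
    · intro a b hab
      have e : ∀ a : X ⊕ Y, Sum.elim α (fun y => L (Sum.inr (Sum.inl y))) a =
          L (Sum.map id Sum.inl a) := by
        rintro (a | a)
        · exact (hL' (Sum.inl a)).symm
        · rfl
      rw [e, e]
      exact hL _ _ (Relation.EqvGen.rel _ _ (Union.left hab))
    · intro a b hab
      have e : ∀ a : Y ⊕ Z, Sum.elim (fun y => L (Sum.inr (Sum.inl y))) γ a =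
          L (Sum.inr a) := by
        rintro (a | a)
        · rfl
        · exact (hL' (Sum.inr a)).symm
      rw [e, e]
      exact hL _ _ (Relation.EqvGen.rel _ _ (Union.right hab))
  · rintro ⟨β, hR, hS⟩ a b hab
    have key : ∀ p q, Relation.EqvGen (Union R S) p q →
        Sum.elim α (Sum.elim β γ) p = Sum.elim α (Sum.elim β γ) q := by
      intro p q hpq
      induction hpq with
      | rel p q h =>
        cases h with
        | @left a b h => have := hR _ _ h; rcases a with a | a <;> rcases b with b | b <;> exact this
        | right h => exact hS _ _ h
      | refl => rfl
      | symm _ _ _ ih => exact ih.symm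
      | trans _ _ _ _ _ ih1 ih2 => exact ih1.trans ih2
    have := key _ _ hab
    rcases a with a | a <;> rcases b with b | b <;> exact this

theorem compat_one {α β : X → Prop} : Compat (one X) α β ↔ α = β := by
  constructor
  · intro h
    funext x
    exact h (Sum.inl x) (Sum.inr x) rfl
  · rintro rfl a b (hab : Sum.elim id id a = Sum.elim id id b)
    rcases a with a | a <;> rcases b with b | b <;> simp_all

theorem one_comp (R : Setoid (X ⊕ Y)) : comp (one X) R = R :=
  ext_compat fun α β => by simp [compat_comp, compat_one]

theorem comp_one (R : Setoid (X ⊕ Y)) : comp R (one Y) = R :=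
  ext_compat fun α β => by simp [compat_comp, compat_one]

theorem comp_assoc (R : Setoid (X ⊕ Y)) (S : Setoid (Y ⊕ Z)) (T : Setoid (Z ⊕ W)) :
    comp (comp R S) T = comp R (comp S T) :=
  ext_compat fun α β => by
    simp only [compat_comp]
    constructor
    · rintro ⟨γ, ⟨δ, h1, h2⟩, h3⟩
      exact ⟨δ, h1, γ, h2, h3⟩
    · rintro ⟨δ, h1, γ, h2, h3⟩
      exact ⟨γ, ⟨δ, h1, h2⟩, h3⟩

/-- `Succ R` adds to the partition of `R`, a split equivalence from `n` to `m`, the class whose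
elements are `n` in the source and `m` in the target. -/
def Succ {n m : ℕ} (R : Setoid (Fin n ⊕ Fin m)) : Setoid (Fin (n + 1) ⊕ Fin (m + 1)) where
  r p q :=
    (p ∈ ({Sum.inl (Fin.last n), Sum.inr (Fin.last m)} : Set (Fin (n + 1) ⊕ Fin (m + 1))) ∧
      q ∈ ({Sum.inl (Fin.last n), Sum.inr (Fin.last m)} : Set (Fin (n + 1) ⊕ Fin (m + 1)))) ∨
    ∃ a b, R a b ∧ p = Sum.map Fin.castSucc Fin.castSucc a ∧ q = Sum.map Fin.castSucc Fin.castSucc b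
  iseqv := by
    have inj : Function.Injective
        (Sum.map (Fin.castSucc (n := n)) (Fin.castSucc (n := m))) :=
      (Fin.castSucc_injective n).sumMap (Fin.castSucc_injective m)
    have hne : ∀ a : Fin n ⊕ Fin m, Sum.map Fin.castSucc Fin.castSucc a ∉
        ({Sum.inl (Fin.last n), Sum.inr (Fin.last m)} : Set (Fin (n + 1) ⊕ Fin (m + 1))) := by
      rintro (a | a) <;> simp [Fin.ext_iff, a.2.ne]
    refine ⟨?_, ?_, ?_⟩
    · rintro (p | p)
      · induction p using Fin.lastCases with
        | last => left; simp
        | cast i => right; exact ⟨Sum.inl i, Sum.inl i, R.refl' _, rfl, rfl⟩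
      · induction p using Fin.lastCases with
        | last => left; simp
        | cast i => right; exact ⟨Sum.inr i, Sum.inr i, R.refl' _, rfl, rfl⟩
    · rintro p q (⟨h1, h2⟩ | ⟨a, b, h, h1, h2⟩)
      · exact Or.inl ⟨h2, h1⟩
      · exact Or.inr ⟨b, a, R.symm' h, h2, h1⟩
    · rintro p q r (⟨h1, h2⟩ | ⟨a, b, h, rfl, rfl⟩) (⟨h3, h4⟩ | ⟨c, d, h', e, rfl⟩)
      · exact Or.inl ⟨h1, h4⟩
      · subst e; exact absurd h2 (hne c)
      · exact absurd h3 (hne b)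
      · have := inj e
        subst this
        exact Or.inr ⟨a, d, R.trans' h h', rfl, rfl⟩

/-- The elements `0, …, n - 1` of source and target are linked; `n` in the source is alone. -/
def epsBox (n : ℕ) : Setoid (Fin (n + 1) ⊕ Fin n) :=
  Setoid.ker (Sum.elim id Fin.castSucc)

/-- The elements `0, …, n - 1` of source and target are linked; `n` in the target is alone. -/
def epsDia (n : ℕ) : Setoid (Fin n ⊕ Fin (n + 1)) :=
  Setoid.ker (Sum.elim Fin.castSucc id)

/-- The map sending `0, …, n` to themselves and `n + 1` to `n`. -/
def merge (n : ℕ) : Fin (n + 2) → Fin (n + 1) :=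
  Fin.lastCases (Fin.last n) id

/-- The elements `0, …, n` of source and target are linked, and `n + 1` in the target is linked to
the two `n`'s (a cap `(n, n + 1)`). -/
def deltaBox (n : ℕ) : Setoid (Fin (n + 1) ⊕ Fin (n + 2)) :=
  Setoid.ker (Sum.elim id (merge n))

/-- The elements `0, …, n` of source and target are linked, and `n + 1` in the source is linked to
the two `n`'s (a cup `(n, n + 1)`). -/
def deltaDia (n : ℕ) : Setoid (Fin (n + 2) ⊕ Fin (n + 1)) :=
  Setoid.ker (Sum.elim (merge n) id)

theorem compat_ker_left {φ : X → Y} {α : X → Prop} {β : Y → Prop} :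
    Compat (Setoid.ker (Sum.elim φ id)) α β ↔ α = β ∘ φ := by
  constructor
  · intro h
    funext x
    exact h (Sum.inl x) (Sum.inr (φ x)) rfl
  · rintro rfl a b (hab : Sum.elim φ id a = Sum.elim φ id b)
    have : ∀ a, Sum.elim (β ∘ φ) β a = β (Sum.elim φ id a) := by rintro (a | a) <;> rfl
    rw [this, this, hab]

theorem compat_ker_right {φ : Y → X} {α : X → Prop} {β : Y → Prop} :
    Compat (Setoid.ker (Sum.elim id φ)) α β ↔ β = α ∘ φ := by
  constructor
  · intro h
    funext y
    exact h (Sum.inr y) (Sum.inl (φ y)) rfl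
  · rintro rfl a b (hab : Sum.elim id φ a = Sum.elim id φ b)
    have : ∀ a, Sum.elim α (α ∘ φ) a = α (Sum.elim id φ a) := by rintro (a | a) <;> rfl
    rw [this, this, hab]

theorem compat_epsBox {n : ℕ} {α : Fin (n + 1) → Prop} {β : Fin n → Prop} :
    Compat (epsBox n) α β ↔ β = Fin.init α := compat_ker_right

theorem compat_epsDia {n : ℕ} {α : Fin n → Prop} {β : Fin (n + 1) → Prop} :
    Compat (epsDia n) α β ↔ α = Fin.init β := compat_ker_left

theorem comp_merge {n : ℕ} (α : Fin (n + 1) → Prop) :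
    α ∘ merge n = Fin.snoc (α := fun _ => Prop) α (α (Fin.last n)) := by
  funext i
  induction i using Fin.lastCases <;> simp [merge]

theorem compat_deltaBox {n : ℕ} {α : Fin (n + 1) → Prop} {β : Fin (n + 2) → Prop} :
    Compat (deltaBox n) α β ↔ β = Fin.snoc (α := fun _ => Prop) α (α (Fin.last n)) := by
  rw [← comp_merge]; exact compat_ker_right

theorem compat_deltaDia {n : ℕ} {α : Fin (n + 2) → Prop} {β : Fin (n + 1) → Prop} :
    Compat (deltaDia n) α β ↔ α = Fin.snoc (α := fun _ => Prop) β (β (Fin.last n)) := by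
  rw [← comp_merge]; exact compat_ker_left

theorem compat_Succ {n m : ℕ} {R : Setoid (Fin n ⊕ Fin m)} {α : Fin (n + 1) → Prop}
    {β : Fin (m + 1) → Prop} : Compat (Succ R) α β ↔
      α (Fin.last n) = β (Fin.last m) ∧ Compat R (Fin.init α) (Fin.init β) := by
  have e : ∀ a : Fin n ⊕ Fin m, Sum.elim α β (Sum.map Fin.castSucc Fin.castSucc a) =
      Sum.elim (Fin.init (α := fun _ => Prop) α) (Fin.init (α := fun _ => Prop) β) a := by
    rintro (a | a) <;> rfl
  constructor
  · intro h
    refine ⟨h (Sum.inl (Fin.last n)) (Sum.inr (Fin.last m)) (Or.inl ⟨by simp, by simp⟩), ?_⟩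
    intro a b hab
    rw [← e, ← e]
    exact h _ _ (Or.inr ⟨a, b, hab, rfl, rfl⟩)
  · rintro ⟨h1, h2⟩ p q (⟨hp, hq⟩ | ⟨a, b, h, rfl, rfl⟩)
    · rcases hp with rfl | rfl <;> rcases hq with rfl | rfl <;> simp [h1]
    · rw [e, e]
      exact h2 a b h

/-! The equations between split equivalences needed for the functoriality of `G`. -/

theorem eq_snoc {n : ℕ} {α : Fin n → Prop} {β : Fin (n + 1) → Prop} {x : Prop} :
    β = Fin.snoc (α := fun _ => Prop) α x ↔
      Fin.init (α := fun _ => Prop) β = α ∧ β (Fin.last n) = x := by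
  constructor
  · rintro rfl; simp
  · rintro ⟨rfl, rfl⟩; simp

theorem exists_snoc {n : ℕ} {P : (Fin (n + 1) → Prop) → Prop} :
    (∃ β, P β) ↔ ∃ (β : Fin n → Prop) (x : Prop), P (Fin.snoc (α := fun _ => Prop) β x) := by
  constructor
  · rintro ⟨β, h⟩
    exact ⟨Fin.init (α := fun _ => Prop) β, β (Fin.last n), by simpa using h⟩
  · rintro ⟨β, x, h⟩
    exact ⟨_, h⟩

theorem forall_snoc {n : ℕ} {P : (Fin (n + 1) → Prop) → Prop} :
    (∀ β, P β) ↔ ∀ (β : Fin n → Prop) (x : Prop), P (Fin.snoc (α := fun _ => Prop) β x) :=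
  ⟨fun h _ _ => h _, fun h β => by simpa using h (Fin.init (α := fun _ => Prop) β) (β (Fin.last n))⟩

theorem snoc_inj {n : ℕ} {α β : Fin n → Prop} {x y : Prop} :
    Fin.snoc (α := fun _ => Prop) α x = Fin.snoc (α := fun _ => Prop) β y ↔ α = β ∧ x = y := by
  rw [eq_snoc]; simp

section Laws

variable {n m k : ℕ}

theorem Succ_one : Succ (one (Fin n)) = one (Fin (n + 1)) := by
  apply ext_compat
  simp only [forall_snoc, compat_Succ, compat_one, snoc_inj, Fin.init_snoc, Fin.snoc_last]
  tauto

theorem Succ_comp (R : Setoid (Fin n ⊕ Fin m)) (S : Setoid (Fin m ⊕ Fin k)) :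
    Succ (comp R S) = comp (Succ R) (Succ S) := by
  apply ext_compat
  simp only [forall_snoc, exists_snoc, compat_Succ, compat_comp, Fin.init_snoc, Fin.snoc_last]
  intro α x β y
  constructor
  · rintro ⟨rfl, γ, h⟩
    exact ⟨γ, x, ⟨rfl, h.1⟩, rfl, h.2⟩
  · rintro ⟨γ, z, ⟨rfl, h1⟩, rfl, h2⟩
    exact ⟨rfl, γ, h1, h2⟩

theorem epsBox_nat (R : Setoid (Fin n ⊕ Fin m)) :
    comp (Succ R) (epsBox m) = comp (epsBox n) R := by
  apply ext_compat
  simp only [forall_snoc, exists_snoc, compat_Succ, compat_comp, compat_epsBox, Fin.init_snoc,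
    Fin.snoc_last]
  intro α x β
  constructor
  · rintro ⟨γ, z, ⟨rfl, h⟩, rfl⟩
    exact ⟨α, rfl, h⟩
  · rintro ⟨_, rfl, h⟩
    exact ⟨β, x, ⟨rfl, h⟩, rfl⟩

theorem epsDia_nat (R : Setoid (Fin n ⊕ Fin m)) :
    comp (epsDia n) (Succ R) = comp R (epsDia m) := by
  apply ext_compat
  simp only [forall_snoc, exists_snoc, compat_Succ, compat_comp, compat_epsDia, Fin.init_snoc,
    Fin.snoc_last]
  intro α β y
  constructor
  · rintro ⟨γ, z, rfl, rfl, h⟩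
    exact ⟨β, h, rfl⟩
  · rintro ⟨_, h, rfl⟩
    exact ⟨α, y, rfl, rfl, h⟩

theorem deltaBox_nat (R : Setoid (Fin n ⊕ Fin m)) :
    comp (deltaBox n) (Succ (Succ R)) = comp (Succ R) (deltaBox m) := by
  apply ext_compat
  simp only [forall_snoc, exists_snoc, compat_Succ, compat_comp, compat_deltaBox, Fin.init_snoc,
    Fin.snoc_last, snoc_inj]
  intro α x β y z
  constructor
  · rintro ⟨γ, u, v, ⟨⟨rfl, rfl⟩, rfl⟩, rfl, rfl, h⟩
    exact ⟨β, _, ⟨rfl, h⟩, ⟨rfl, rfl⟩, rfl⟩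
  · rintro ⟨γ, u, ⟨rfl, h⟩, ⟨rfl, rfl⟩, rfl⟩
    exact ⟨α, _, _, ⟨⟨rfl, rfl⟩, rfl⟩, rfl, rfl, h⟩

theorem deltaDia_nat (R : Setoid (Fin n ⊕ Fin m)) :
    comp (Succ (Succ R)) (deltaDia m) = comp (deltaDia n) (Succ R) := by
  apply ext_compat
  simp only [forall_snoc, exists_snoc, compat_Succ, compat_comp, compat_deltaDia, Fin.init_snoc,
    Fin.snoc_last, snoc_inj]
  intro α x y β z
  constructor
  · rintro ⟨γ, u, v, ⟨rfl, rfl, h⟩, ⟨rfl, rfl⟩, rfl⟩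
    exact ⟨α, _, ⟨⟨rfl, rfl⟩, rfl⟩, rfl, h⟩
  · rintro ⟨γ, u, ⟨⟨rfl, rfl⟩, rfl⟩, rfl, h⟩
    exact ⟨β, _, _, ⟨rfl, rfl, h⟩, ⟨rfl, rfl⟩, rfl⟩

theorem deltaBox_assoc :
    comp (deltaBox n) (Succ (deltaBox n)) = comp (deltaBox n) (deltaBox (n + 1)) := by
  apply ext_compat
  simp only [forall_snoc, exists_snoc, compat_Succ, compat_comp, compat_deltaBox, Fin.init_snoc,
    Fin.snoc_last, snoc_inj]
  intros
  simp only [existsAndEq, and_true, true_and]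
  constructor <;> (simp only [and_imp]; intros; subst_vars; simp)

theorem deltaDia_assoc :
    comp (Succ (deltaDia n)) (deltaDia n) = comp (deltaDia (n + 1)) (deltaDia n) := by
  apply ext_compat
  simp only [forall_snoc, exists_snoc, compat_Succ, compat_comp, compat_deltaDia, Fin.init_snoc,
    Fin.snoc_last, snoc_inj]
  intros
  simp only [existsAndEq, and_true, true_and]
  constructor <;> (simp only [and_imp]; intros; subst_vars; simp)

theorem box_beta : comp (deltaBox n) (epsBox (n + 1)) = one (Fin (n + 1)) := by
  apply ext_compat
  simp only [forall_snoc, exists_snoc, compat_comp, compat_deltaBox, compat_epsBox, compat_one,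
    Fin.init_snoc, Fin.snoc_last, snoc_inj]
  intros
  simp only [existsAndEq, and_true, true_and, exists_and_left, exists_and_right]
  constructor <;> (simp only [and_imp]; intros; subst_vars; simp)

theorem dia_beta : comp (epsDia (n + 1)) (deltaDia n) = one (Fin (n + 1)) := by
  apply ext_compat
  simp only [forall_snoc, exists_snoc, compat_comp, compat_deltaDia, compat_epsDia, compat_one,
    Fin.init_snoc, Fin.snoc_last, snoc_inj]
  intros
  simp only [existsAndEq, and_true, true_and, exists_and_left]

theorem box_eta : comp (deltaBox n) (Succ (epsBox n)) = one (Fin (n + 1)) := by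
  apply ext_compat
  simp only [forall_snoc, exists_snoc, compat_comp, compat_Succ, compat_deltaBox, compat_epsBox,
    compat_one, Fin.init_snoc, Fin.snoc_last, snoc_inj]
  intros
  simp only [existsAndEq, and_true, true_and, exists_and_left, exists_and_right]
  constructor <;> (simp only [and_imp]; intros; subst_vars; simp)

theorem dia_eta : comp (Succ (epsDia n)) (deltaDia n) = one (Fin (n + 1)) := by
  apply ext_compat
  simp only [forall_snoc, exists_snoc, compat_comp, compat_Succ, compat_deltaDia, compat_epsDia,
    compat_one, Fin.init_snoc, Fin.snoc_last, snoc_inj]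
  intros
  simp only [existsAndEq, and_true, true_and, exists_and_left, exists_and_right]

theorem delta_N :
    comp (deltaBox (n + 1)) (Succ (deltaDia n)) = comp (deltaDia n) (deltaBox n) := by
  apply ext_compat
  simp only [forall_snoc, exists_snoc, compat_comp, compat_Succ, compat_deltaDia, compat_deltaBox,
    Fin.init_snoc, Fin.snoc_last, snoc_inj]
  intros
  simp only [existsAndEq, and_true, true_and]
  constructor <;> (simp only [and_imp]; intros; subst_vars; simp)

theorem delta_I :
    comp (Succ (deltaBox n)) (deltaDia (n + 1)) = comp (deltaDia n) (deltaBox n) := by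
  apply ext_compat
  simp only [forall_snoc, exists_snoc, compat_comp, compat_Succ, compat_deltaDia, compat_deltaBox,
    Fin.init_snoc, Fin.snoc_last, snoc_inj]
  intros
  simp only [existsAndEq, and_true, true_and]
  constructor <;> (simp only [and_imp]; intros; subst_vars; simp)

end Laws

end SplitEquiv

/-- The category of split equivalences: objects are the finite ordinals, and an arrow from `n`
to `m` is an equivalence relation on the disjoint union of `n` and `m`. -/
structure Gen where
  /-- the underlying finite ordinal -/
  ord : ℕ

instance : Category Gen where
  Hom n m := Setoid (Fin n.ord ⊕ Fin m.ord)
  id n := SplitEquiv.one (Fin n.ord)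
  comp R S := SplitEquiv.comp R S
  id_comp := SplitEquiv.one_comp
  comp_id := SplitEquiv.comp_one
  assoc := SplitEquiv.comp_assoc

/-! ### The syntactic category of positive modalities -/

/-- The two modal operators. -/
inductive ModalOp
  | box
  | dia

/-- A (positive) modality is a finite sequence of modal operators; the head of the list is the
outermost operator. -/
abbrev Modality := List ModalOp

namespace S5

open ModalOp

/-- Arrow terms. `comp g f` is `g ∘ f`. -/
inductive Term : Modality → Modality → Type
  | one (A : Modality) : Term A A
  | epsBox (A : Modality) : Term (box :: A) A
  | epsDia (A : Modality) : Term A (dia :: A)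
  | deltaBox (M : ModalOp) (A : Modality) : Term (M :: A) (box :: M :: A)
  | deltaDia (M : ModalOp) (A : Modality) : Term (dia :: M :: A) (M :: A)
  | comp {A B C : Modality} (g : Term B C) (f : Term A B) : Term A C
  | map (M : ModalOp) {A B : Modality} (f : Term A B) : Term (M :: A) (M :: B)

open Term

/-- The equations between arrow terms: the smallest congruence satisfying the axioms. -/
inductive Eqn : {A B : Modality} → Term A B → Term A B → Prop
  | refl {A B : Modality} (f : Term A B) : Eqn f f
  | symm {A B : Modality} {f g : Term A B} : Eqn f g → Eqn g f
  | trans {A B : Modality} {f g h : Term A B} : Eqn f g → Eqn g h → Eqn f h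
  | comp_congr {A B C : Modality} {g g' : Term B C} {f f' : Term A B} :
      Eqn g g' → Eqn f f' → Eqn (comp g f) (comp g' f')
  | map_congr (M : ModalOp) {A B : Modality} {f f' : Term A B} :
      Eqn f f' → Eqn (map M f) (map M f')
  -- categorial equations
  | comp_one {A B : Modality} (f : Term A B) : Eqn (comp f (one A)) f
  | one_comp {A B : Modality} (f : Term A B) : Eqn (comp (one B) f) f
  | assoc {A B C D : Modality} (h : Term C D) (g : Term B C) (f : Term A B) :
      Eqn (comp h (comp g f)) (comp (comp h g) f)
  -- functorial equations
  | map_one (M : ModalOp) (A : Modality) : Eqn (map M (one A)) (one (M :: A))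
  | map_comp (M : ModalOp) {A B C : Modality} (g : Term B C) (f : Term A B) :
      Eqn (map M (comp g f)) (comp (map M g) (map M f))
  -- naturality equations
  | epsBox_nat {A B : Modality} (f : Term A B) :
      Eqn (comp (epsBox B) (map box f)) (comp f (epsBox A))
  | epsDia_nat {A B : Modality} (f : Term A B) :
      Eqn (comp (map dia f) (epsDia A)) (comp (epsDia B) f)
  | deltaBox_nat (M : ModalOp) {A B : Modality} (f : Term A B) :
      Eqn (comp (map box (map M f)) (deltaBox M A)) (comp (deltaBox M B) (map M f))
  | deltaDia_nat (M : ModalOp) {A B : Modality} (f : Term A B) :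
      Eqn (comp (deltaDia M B) (map dia (map M f))) (comp (map M f) (deltaDia M A))
  -- coassociativity and associativity
  | deltaBox_assoc (M : ModalOp) (A : Modality) :
      Eqn (comp (map box (deltaBox M A)) (deltaBox M A))
        (comp (deltaBox box (M :: A)) (deltaBox M A))
  | deltaDia_assoc (M : ModalOp) (A : Modality) :
      Eqn (comp (deltaDia M A) (map dia (deltaDia M A)))
        (comp (deltaDia M A) (deltaDia dia (M :: A)))
  -- the `β` and `η` equations; the latter are for `□□` and `◇◇` only
  | box_beta (M : ModalOp) (A : Modality) :
      Eqn (comp (epsBox (M :: A)) (deltaBox M A)) (one (M :: A))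
  | dia_beta (M : ModalOp) (A : Modality) :
      Eqn (comp (deltaDia M A) (epsDia (M :: A))) (one (M :: A))
  | box_eta (A : Modality) :
      Eqn (comp (map box (epsBox A)) (deltaBox box A)) (one (box :: A))
  | dia_eta (A : Modality) :
      Eqn (comp (deltaDia dia A) (map dia (epsDia A))) (one (dia :: A))
  -- the Frobenius-like equations
  | delta_N (M : ModalOp) (A : Modality) :
      Eqn (comp (map box (deltaDia M A)) (deltaBox dia (M :: A)))
        (comp (deltaBox M A) (deltaDia M A))
  | delta_I (M : ModalOp) (A : Modality) :
      Eqn (comp (deltaDia box (M :: A)) (map dia (deltaBox M A)))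
        (comp (deltaBox M A) (deltaDia M A))

/-- Arrow terms of a given type modulo the equations. -/
instance termSetoid (A B : Modality) : Setoid (Term A B) where
  r := Eqn
  iseqv := ⟨Eqn.refl, Eqn.symm, Eqn.trans⟩

/-- The split equivalence assigned to an arrow term. -/
def interp : {A B : Modality} → Term A B → Setoid (Fin A.length ⊕ Fin B.length)
  | _, _, .one A => SplitEquiv.one (Fin A.length)
  | _, _, .epsBox A => SplitEquiv.epsBox A.length
  | _, _, .epsDia A => SplitEquiv.epsDia A.length
  | _, _, .deltaBox _ A => SplitEquiv.deltaBox A.length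
  | _, _, .deltaDia _ A => SplitEquiv.deltaDia A.length
  | _, _, .comp g f => SplitEquiv.comp (interp f) (interp g)
  | _, _, .map _ f => SplitEquiv.Succ (interp f)

theorem interp_eq {A B : Modality} {f g : Term A B} (h : Eqn f g) : interp f = interp g := by
  induction h with
  | refl => rfl
  | symm _ ih => exact ih.symm
  | trans _ _ ih1 ih2 => exact ih1.trans ih2
  | comp_congr _ _ ih1 ih2 => simp only [interp, ih1, ih2]
  | map_congr M _ ih => simp only [interp, ih]
  | comp_one f => exact SplitEquiv.one_comp _
  | one_comp f => exact SplitEquiv.comp_one _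
  | assoc h g f => exact SplitEquiv.comp_assoc _ _ _
  | map_one M A => exact SplitEquiv.Succ_one
  | map_comp M g f => exact SplitEquiv.Succ_comp _ _
  | epsBox_nat f => exact SplitEquiv.epsBox_nat _
  | epsDia_nat f => exact SplitEquiv.epsDia_nat _
  | deltaBox_nat M f => exact SplitEquiv.deltaBox_nat _
  | deltaDia_nat M f => exact SplitEquiv.deltaDia_nat _
  | deltaBox_assoc M A => exact SplitEquiv.deltaBox_assoc
  | deltaDia_assoc M A => exact SplitEquiv.deltaDia_assoc
  | box_beta M A => exact SplitEquiv.box_beta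
  | dia_beta M A => exact SplitEquiv.dia_beta
  | box_eta A => exact SplitEquiv.box_eta
  | dia_eta A => exact SplitEquiv.dia_eta
  | delta_N M A => exact SplitEquiv.delta_N
  | delta_I M A => exact SplitEquiv.delta_I

end S5

/-- The category `S5_{□◇}`: objects are modalities, arrows are equivalence classes of arrow
terms. -/
structure S5 where
  /-- the underlying modality -/
  word : Modality

namespace S5

instance : Category S5 where
  Hom A B := Quotient (termSetoid A.word B.word)
  id A := Quotient.mk _ (Term.one A.word)
  comp f g := Quotient.map₂ (fun f g => Term.comp g f)
    (fun _ _ hf _ _ hg => Eqn.comp_congr hg hf) f g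
  id_comp := by rintro A B ⟨f⟩; exact Quotient.sound (Eqn.comp_one f)
  comp_id := by rintro A B ⟨f⟩; exact Quotient.sound (Eqn.one_comp f)
  assoc := by rintro A B C D ⟨f⟩ ⟨g⟩ ⟨h⟩; exact Quotient.sound (Eqn.assoc h g f)

/-- The functor `G` from `S5_{□◇}` to `Gen`: on objects the length of a modality, on arrows the
split equivalence assigned to any arrow term that represents the arrow. -/
def G : S5 ⥤ Gen where
  obj A := ⟨A.word.length⟩
  map f := Quotient.lift interp (fun _ _ h => interp_eq h) f
  map_id _ := rfl
  map_comp := by rintro A B C ⟨f⟩ ⟨g⟩; rfl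

end S5

/-!
`S5_{□◇}` behaves like the category of planar string diagrams for an adjoint triple `L ⊣ U ⊣ R` with
`◇ = UL` and `□ = UR`. In this picture `ε^□` and `δ^{◇M}` are the counits ("contractions", which
shorten a modality by one letter), and `ε^◇` and `δ^{□M}` are the units ("expansions"). The
triangle identities appear as the `β` and `η` equations, and all the other equations, those of
Frobenius included, say that independent steps can be exchanged.

The proof of faithfulness has two halves.

* Every arrow is a sequence of contractions followed by a sequence of expansions (`normal`). An
  expansion followed by a contraction either cancels or can be exchanged (`switch`).

* Such a factorization is determined by the split equivalence of the arrow. A split equivalence is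
  recorded by the relation between `Prop`-valued labellings of source and target that are jointly
  constant on its classes (`Sem`). For a contraction this relation is a surjective partial function,
  for an expansion the converse of one. If the relation of a sequence of contractions factors
  through that of a contraction `k`, the sequence can be rearranged to begin with `k`
  (`ContractionModel.exists_extraction`). This rests on the local confluence of contractions
  (`ContractionModel.peak`). Its only failure, at `◇□A` under a prefix, where `□` may be merged with
  `◇` or deleted, is detected by labellings. Hence both the middle modality and the sequence of
  contractions can be read off from the relation (`ContractionModel.homs_unique`). Since this is
  proved for any `ContractionModel`, of which the opposite of `S5` is another instance, it applies
  to the expansions as well.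
-/

namespace S5

open ModalOp SplitEquiv

/-! ### Arrows and their action on labellings -/

/-- The operation `f ↦ M f` on arrows of `S5`. -/
def mapHom (M : ModalOp) {A B : Modality} (f : S5.mk A ⟶ S5.mk B) :
    S5.mk (M :: A) ⟶ S5.mk (M :: B) :=
  Quotient.map (Term.map M) (fun _ _ h => Eqn.map_congr M h) f

/-- The arrow of `S5` represented by an arrow term. -/
def ofTerm {A B : Modality} (t : Term A B) : S5.mk A ⟶ S5.mk B :=
  Quotient.mk (termSetoid A B) t

theorem ofTerm_eq {A B : Modality} {s t : Term A B} (h : Eqn s t) : ofTerm s = ofTerm t :=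
  Quotient.sound h

theorem ofTerm_surjective {A B : Modality} (f : S5.mk A ⟶ S5.mk B) : ∃ t, ofTerm t = f :=
  Quotient.exists_rep f

theorem mapHom_id (M : ModalOp) (A : Modality) : mapHom M (𝟙 (S5.mk A)) = 𝟙 (S5.mk (M :: A)) :=
  ofTerm_eq (Eqn.map_one M A)

theorem mapHom_comp (M : ModalOp) {A B C : Modality} (f : S5.mk A ⟶ S5.mk B)
    (g : S5.mk B ⟶ S5.mk C) : mapHom M (f ≫ g) = mapHom M f ≫ mapHom M g := by
  obtain ⟨f, rfl⟩ := ofTerm_surjective f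
  obtain ⟨g, rfl⟩ := ofTerm_surjective g
  exact ofTerm_eq (Eqn.map_comp M g f)

/-- A truth value for each letter of a modality. These are the labellings by which
`SplitEquiv.Compat` tests split equivalences, arranged so that the outermost letter comes first. -/
def Labelling : Modality → Type
  | [] => Unit
  | _ :: A => Prop × Labelling A

namespace Labelling

/-- The label of the outermost letter sits at the last ordinal. -/
def toFin : {A : Modality} → Labelling A → Fin A.length → Prop
  | [], _ => Fin.elim0
  | _ :: _, α => Fin.snoc (α := fun _ => Prop) (toFin α.2) α.1

theorem toFin_cons {M : ModalOp} {A : Modality} (α : Labelling (M :: A)) :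
    α.toFin = Fin.snoc (α := fun _ => Prop) (toFin α.2) α.1 := rfl

theorem toFin_inj {A : Modality} {α β : Labelling A} : α.toFin = β.toFin ↔ α = β := by
  refine ⟨fun h => ?_, fun h => h ▸ rfl⟩
  induction A with
  | nil => rfl
  | cons M A ih =>
    obtain ⟨h1, h2⟩ := snoc_inj.1 h
    exact Prod.ext h2 (ih h1)

theorem toFin_surjective {A : Modality} (v : Fin A.length → Prop) :
    ∃ α : Labelling A, α.toFin = v := by
  induction A with
  | nil => exact ⟨(), funext fun i => i.elim0⟩
  | cons M A ih =>
    obtain ⟨α, h⟩ := ih (Fin.init (α := fun _ => Prop) v)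
    exact ⟨(v (Fin.last _), α), (congrArg (fun w => Fin.snoc (α := fun _ => Prop) w
      (v (Fin.last _))) h).trans (Fin.snoc_init_self v)⟩

instance instNonempty (A : Modality) : Nonempty (Labelling A) :=
  ⟨(toFin_surjective fun _ => True).choose⟩

end Labelling

/-- The relation between labellings given by an arrow: together they are constant on the classes
of its split equivalence. -/
def Sem {A B : Modality} (f : S5.mk A ⟶ S5.mk B) (α : Labelling A) (β : Labelling B) : Prop :=
  Compat (X := Fin A.length) (Y := Fin B.length) (G.map f) α.toFin β.toFin

theorem Sem_ofTerm {A B : Modality} (t : Term A B) (α : Labelling A) (β : Labelling B) :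
    Sem (ofTerm t) α β ↔ Compat (interp t) α.toFin β.toFin := Iff.rfl

theorem Sem_id {A : Modality} (α β : Labelling A) : Sem (𝟙 (S5.mk A)) α β ↔ α = β :=
  compat_one.trans Labelling.toFin_inj

theorem Sem_comp {A B C : Modality} (f : S5.mk A ⟶ S5.mk B) (g : S5.mk B ⟶ S5.mk C)
    (α : Labelling A) (γ : Labelling C) : Sem (f ≫ g) α γ ↔ ∃ β, Sem f α β ∧ Sem g β γ := by
  obtain ⟨f, rfl⟩ := ofTerm_surjective f
  obtain ⟨g, rfl⟩ := ofTerm_surjective g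
  refine (compat_comp (R := interp f) (S := interp g)).trans ?_
  constructor
  · rintro ⟨v, h⟩
    obtain ⟨β, rfl⟩ := Labelling.toFin_surjective v
    exact ⟨β, h⟩
  · rintro ⟨β, h⟩
    exact ⟨β.toFin, h⟩

theorem Sem_mapHom (M : ModalOp) {A B : Modality} (f : S5.mk A ⟶ S5.mk B)
    (α : Labelling (M :: A)) (β : Labelling (M :: B)) :
    Sem (mapHom M f) α β ↔ α.1 = β.1 ∧ Sem f α.2 β.2 := by
  obtain ⟨f, rfl⟩ := ofTerm_surjective f
  refine (compat_Succ (R := interp f)).trans ?_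
  simp only [Labelling.toFin_cons, Fin.init_snoc, Fin.snoc_last, Sem_ofTerm]

theorem Sem_epsBox {A : Modality} (α : Labelling (box :: A)) (β : Labelling A) :
    Sem (ofTerm (.epsBox A)) α β ↔ α.2 = β := by
  refine compat_epsBox.trans ?_
  rw [Labelling.toFin_cons, Fin.init_snoc, Labelling.toFin_inj, eq_comm]

theorem Sem_epsDia {A : Modality} (α : Labelling A) (β : Labelling (dia :: A)) :
    Sem (ofTerm (.epsDia A)) α β ↔ β.2 = α := by
  refine compat_epsDia.trans ?_
  rw [Labelling.toFin_cons, Fin.init_snoc, Labelling.toFin_inj, eq_comm]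

theorem toFin_eq_double {M N : ModalOp} {A : Modality} (α : Labelling (M :: N :: A))
    (β : Labelling (N :: A)) :
    α.toFin = Fin.snoc (α := fun _ => Prop) β.toFin (β.toFin (Fin.last _)) ↔
      α.1 = α.2.1 ∧ α.2 = β := by
  rw [Labelling.toFin_cons, snoc_inj, Labelling.toFin_inj, Labelling.toFin_cons, Fin.snoc_last]
  constructor
  · rintro ⟨rfl, h⟩; exact ⟨h, rfl⟩
  · rintro ⟨h, rfl⟩; exact ⟨rfl, h⟩

theorem Sem_deltaBox {M : ModalOp} {A : Modality} (α : Labelling (M :: A))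
    (β : Labelling (box :: M :: A)) :
    Sem (ofTerm (.deltaBox M A)) α β ↔ β.1 = β.2.1 ∧ β.2 = α :=
  compat_deltaBox.trans (toFin_eq_double β α)

theorem Sem_deltaDia {M : ModalOp} {A : Modality} (α : Labelling (dia :: M :: A))
    (β : Labelling (M :: A)) :
    Sem (ofTerm (.deltaDia M A)) α β ↔ α.1 = α.2.1 ∧ α.2 = β :=
  compat_deltaDia.trans (toFin_eq_double α β)

/-! ### Contractions -/

/-- The elementary ways of shortening a modality: deleting a letter `b`, or merging a letter `d`
with the letter to its right, anywhere in the word. For `b = □` and `d = ◇` these are the shapes of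
`ε^□` and `δ^{◇M}` under a prefix; for `b = ◇` and `d = □` those of the arrows `ε^◇` and `δ^{□M}`
read backwards. -/
inductive Contraction (b d : ModalOp) : Modality → Modality → Type
  | eps (A : Modality) : Contraction b d (b :: A) A
  | delta (M : ModalOp) (A : Modality) : Contraction b d (d :: M :: A) (M :: A)
  | map (M : ModalOp) {A B : Modality} (k : Contraction b d A B) : Contraction b d (M :: A) (M :: B)

/-- Composable sequences of contractions. -/
inductive Contractions (b d : ModalOp) : Modality → Modality → Type
  | nil (A : Modality) : Contractions b d A A
  | cons {A B C : Modality} (k : Contraction b d A B) (p : Contractions b d B C) :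
      Contractions b d A C

variable {b d : ModalOp}

/-- The relation between labellings induced by a contraction: a partial function, defined where
the labels of merged letters agree. -/
def Contraction.rel : {A B : Modality} → Contraction b d A B → Labelling A → Labelling B → Prop
  | _, _, .eps _, α, β => α.2 = β
  | _, _, .delta _ _, α, β => α.1 = α.2.1 ∧ α.2 = β
  | _, _, .map _ k, α, β => α.1 = β.1 ∧ k.rel α.2 β.2

/-- The relation between labellings induced by a sequence of contractions. -/
def Contractions.rel : {A B : Modality} → Contractions b d A B → Labelling A → Labelling B → Prop
  | _, _, .nil _, α, β => α = β
  | _, _, .cons k p, α, γ => ∃ β, k.rel α β ∧ p.rel β γ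

namespace Contraction

theorem rel_functional {A B : Modality} (k : Contraction b d A B) {α : Labelling A}
    {β β' : Labelling B} (h : k.rel α β) (h' : k.rel α β') : β = β' := by
  induction k with
  | eps A => exact Eq.trans (Eq.symm h) h'
  | delta M A => exact h.2.symm.trans h'.2
  | map M k ih => exact Prod.ext (h.1.symm.trans h'.1) (ih h.2 h'.2)

theorem rel_surjective {A B : Modality} (k : Contraction b d A B) (β : Labelling B) :
    ∃ α, k.rel α β := by
  induction k with
  | eps A => exact ⟨⟨True, β⟩, rfl⟩
  | delta M A => exact ⟨⟨β.1, β⟩, rfl, rfl⟩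
  | map M k ih =>
    obtain ⟨α, h⟩ := ih β.2
    exact ⟨⟨β.1, α⟩, rfl, h⟩

/-- A contraction is not injective: it is undefined at some labelling, or identifies two. -/
theorem rel_lossy {A B : Modality} (k : Contraction b d A B) :
    (∃ α, ∀ γ, ¬ k.rel α γ) ∨ ∃ α α' γ, α ≠ α' ∧ k.rel α γ ∧ k.rel α' γ := by
  induction k with
  | eps A =>
    obtain ⟨β⟩ := Labelling.instNonempty A
    exact Or.inr ⟨⟨True, β⟩, ⟨False, β⟩, β,
      fun h => true_ne_false (congrArg Prod.fst h), rfl, rfl⟩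
  | delta M A =>
    obtain ⟨β⟩ := Labelling.instNonempty A
    exact Or.inl ⟨⟨True, False, β⟩, fun _ h => true_ne_false h.1⟩
  | map M k ih =>
    rcases ih with ⟨α, h⟩ | ⟨α, α', γ, hne, h, h'⟩
    · exact Or.inl ⟨⟨True, α⟩, fun γ hγ => h γ.2 hγ.2⟩
    · exact Or.inr ⟨⟨True, α⟩, ⟨True, α'⟩, ⟨True, γ⟩,
        fun e => hne (congrArg Prod.snd e), ⟨rfl, h⟩, rfl, h'⟩

/-- A relation `R` absorbs the contraction `k` if it factors through the relation of `k`. -/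
structure Absorbs {A B : Modality} {X : Type} (R : Labelling A → X → Prop)
    (k : Contraction b d A B) : Prop where
  dom : ∀ {α x}, R α x → ∃ γ, k.rel α γ
  invariant : ∀ {α α' γ x}, k.rel α γ → k.rel α' γ → R α x → R α' x

end Contraction

/-- Total injective relations: the converses of surjective partial functions. -/
structure TotalInjective {X Y : Type} (R : X → Y → Prop) : Prop where
  total : ∀ x, ∃ y, R x y
  inj : ∀ {x x' y}, R x y → R x' y → x = x'

/-- By `Contraction.rel_lossy`: a factorization through `k` would make `k` total and injective. -/
theorem TotalInjective.not_absorbs {A B : Modality} {X : Type} {R : Labelling A → X → Prop}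
    (hR : TotalInjective R) (k : Contraction b d A B) : ¬ k.Absorbs R := by
  intro hk
  rcases k.rel_lossy with ⟨α, h⟩ | ⟨α, α', γ, hne, h, h'⟩
  · obtain ⟨x, hx⟩ := hR.total α
    obtain ⟨γ, hγ⟩ := hk.dom hx
    exact h γ hγ
  · obtain ⟨x, hx⟩ := hR.total α
    exact hne (hR.inj hx (hk.invariant h h' hx))

namespace Contractions

theorem rel_functional {A B : Modality} (p : Contractions b d A B) {α : Labelling A}
    {β β' : Labelling B} (h : p.rel α β) (h' : p.rel α β') : β = β' := by
  induction p with
  | nil A => exact Eq.trans (Eq.symm h) h'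
  | cons k p ih =>
    obtain ⟨γ, h1, h2⟩ := h
    obtain ⟨γ', h1', h2'⟩ := h'
    obtain rfl := k.rel_functional h1 h1'
    exact ih h2 h2'

theorem rel_surjective {A B : Modality} (p : Contractions b d A B) (β : Labelling B) :
    ∃ α, p.rel α β := by
  induction p with
  | nil A => exact ⟨β, rfl⟩
  | cons k p ih =>
    obtain ⟨γ, h⟩ := ih β
    obtain ⟨α, h'⟩ := k.rel_surjective γ
    exact ⟨α, γ, h', h⟩

/-- Concatenation of sequences of contractions. -/
def append {A B C : Modality} : Contractions b d A B → Contractions b d B C → Contractions b d A C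
  | .nil _, q => q
  | .cons k p, q => .cons k (p.append q)

/-- A sequence of contractions performed under one more letter. -/
def map (M : ModalOp) {A B : Modality} : Contractions b d A B → Contractions b d (M :: A) (M :: B)
  | .nil _ => .nil _
  | .cons k p => .cons (.map M k) (p.map M)

end Contractions

/-- The structure of `S5` used by contractions with letters `b` and `d`, together with a sound
interpretation by relations between labellings. It is carried by `S5`, with `b = □` and `d = ◇`,
and by its opposite, with `b = ◇` and `d = □`, so that arguments about contractions cover
expansions too. -/
structure ContractionModel (b d : ModalOp) (C : Type) [Category.{0} C] where
  obj : Modality → C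
  map (M : ModalOp) {A B : Modality} : (obj A ⟶ obj B) → (obj (M :: A) ⟶ obj (M :: B))
  eps (A : Modality) : obj (b :: A) ⟶ obj A
  delta (M : ModalOp) (A : Modality) : obj (d :: M :: A) ⟶ obj (M :: A)
  map_id (M : ModalOp) (A : Modality) : map M (𝟙 (obj A)) = 𝟙 (obj (M :: A))
  map_comp (M : ModalOp) {A B D : Modality} (f : obj A ⟶ obj B) (g : obj B ⟶ obj D) :
    map M (f ≫ g) = map M f ≫ map M g
  eps_nat {A B : Modality} (f : obj A ⟶ obj B) : map b f ≫ eps B = eps A ≫ f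
  delta_nat (M : ModalOp) {A B : Modality} (f : obj A ⟶ obj B) :
    map d (map M f) ≫ delta M B = delta M A ≫ map M f
  delta_assoc (M : ModalOp) (A : Modality) :
    map d (delta M A) ≫ delta M A = delta d (M :: A) ≫ delta M A
  Sem {A B : Modality} : (obj A ⟶ obj B) → Labelling A → Labelling B → Prop
  Sem_id {A : Modality} (α β : Labelling A) : Sem (𝟙 (obj A)) α β ↔ α = β
  Sem_comp {A B D : Modality} (f : obj A ⟶ obj B) (g : obj B ⟶ obj D)
    (α : Labelling A) (γ : Labelling D) : Sem (f ≫ g) α γ ↔ ∃ β, Sem f α β ∧ Sem g β γ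
  Sem_map (M : ModalOp) {A B : Modality} (f : obj A ⟶ obj B) (α : Labelling (M :: A))
    (β : Labelling (M :: B)) : Sem (map M f) α β ↔ α.1 = β.1 ∧ Sem f α.2 β.2
  Sem_eps {A : Modality} (α : Labelling (b :: A)) (β : Labelling A) :
    Sem (eps A) α β ↔ α.2 = β
  Sem_delta {M : ModalOp} {A : Modality} (α : Labelling (d :: M :: A))
    (β : Labelling (M :: A)) : Sem (delta M A) α β ↔ α.1 = α.2.1 ∧ α.2 = β

namespace ContractionModel

variable {C : Type} [Category.{0} C] (S : ContractionModel b d C)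

/-- The arrow of a contraction. -/
def hom : {A B : Modality} → Contraction b d A B → (S.obj A ⟶ S.obj B)
  | _, _, .eps A => S.eps A
  | _, _, .delta M A => S.delta M A
  | _, _, .map M k => S.map M (hom k)

/-- The arrow of a sequence of contractions. -/
def homs : {A B : Modality} → Contractions b d A B → (S.obj A ⟶ S.obj B)
  | _, _, .nil A => 𝟙 (S.obj A)
  | _, _, .cons k p => S.hom k ≫ homs p

theorem homs_append {A B D : Modality} (p : Contractions b d A B) (q : Contractions b d B D) :
    S.homs (p.append q) = S.homs p ≫ S.homs q := by
  induction p with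
  | nil A => exact (Category.id_comp _).symm
  | cons k p ih => simp only [Contractions.append, homs, ih, Category.assoc]

theorem homs_map (M : ModalOp) {A B : Modality} (p : Contractions b d A B) :
    S.homs (p.map M) = S.map M (S.homs p) := by
  induction p with
  | nil A => exact (S.map_id M A).symm
  | cons k p ih => simp only [Contractions.map, homs, hom, ih, S.map_comp]

theorem Sem_hom {A B : Modality} (k : Contraction b d A B) (α : Labelling A) (β : Labelling B) :
    S.Sem (S.hom k) α β ↔ k.rel α β := by
  induction k with
  | eps A => exact S.Sem_eps α β
  | delta M A => exact S.Sem_delta α β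
  | map M k ih => exact (S.Sem_map M _ α β).trans (and_congr_right fun _ => ih _ _)

theorem Sem_homs {A B : Modality} (p : Contractions b d A B) (α : Labelling A)
    (β : Labelling B) : S.Sem (S.homs p) α β ↔ p.rel α β := by
  induction p with
  | nil A => exact S.Sem_id α β
  | cons k p ih =>
    exact (S.Sem_comp _ _ α β).trans (exists_congr fun γ => and_congr (S.Sem_hom k α γ) (ih γ β))

/-! ### Extraction of a contraction from a sequence -/

open Contraction

/-- The possible relations between two contractions `k` and `k'` of the same modality: they are
equal; or they can be continued to a commuting square, in which everything that absorbs `k` after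
`k'` absorbs the side `j'`; or nothing of the form `k'` followed by a nonempty relation absorbs `k`,
either because `k'` is defined outside the domain of `k` (`outside`), or because `k` identifies
labellings that `k'` tells apart by its domain (`separated`). -/
inductive Peak {A B B' : Modality} (k : Contraction b d A B) (k' : Contraction b d A B') : Prop
  | equal (h : (⟨B, k⟩ : Σ B, Contraction b d A B) = ⟨B', k'⟩)
  | square {D : Modality} (j : Contraction b d B D) (j' : Contraction b d B' D)
      (comm : S.hom k ≫ S.hom j = S.hom k' ≫ S.hom j')
      (dom : ∀ γ, (∀ α, k'.rel α γ → ∃ δ, k.rel α δ) → ∃ ε, j'.rel γ ε)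
      (lift : ∀ γ γ' ε, j'.rel γ ε → j'.rel γ' ε →
        ∃ α α' δ, k'.rel α γ ∧ k'.rel α' γ' ∧ k.rel α δ ∧ k.rel α' δ)
  | outside (h : ∀ γ, ∃ α, k'.rel α γ ∧ ∀ δ, ¬ k.rel α δ)
  | separated (h : ∀ γ, ∃ α α' δ, k'.rel α γ ∧ k.rel α δ ∧ k.rel α' δ ∧ ∀ γ', ¬ k'.rel α' γ')

/-- A contraction under the letter `d` against the merging of this letter with the next one. -/
theorem peak_delta {M : ModalOp} {A B : Modality}
    (k : Contraction b d (M :: A) B) :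
    S.Peak (.delta M A) (.map d k) ∧ S.Peak (.map d k) (.delta M A) := by
  cases k with
  | eps =>
    -- the two contractions of `d b A` are incompatible: a labelling with different values at `d`
    -- and at `b` is in the domain of the deletion of `b` only
    exact ⟨.outside fun γ => ⟨⟨γ.1, ¬ γ.1, γ.2⟩, ⟨rfl, rfl⟩,
        fun δ h => not_iff_self (iff_of_eq h.1.symm)⟩,
      .separated fun γ => ⟨⟨γ.1, γ⟩, ⟨γ.1, ¬ γ.1, γ.2⟩, ⟨γ.1, γ.2⟩, ⟨rfl, rfl⟩, ⟨rfl, rfl⟩,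
        ⟨rfl, rfl⟩, fun δ h => not_iff_self (iff_of_eq h.1.symm)⟩⟩
  | delta N A =>
    constructor
    · refine .square (.delta N A) (.delta N A) (S.delta_assoc N A).symm ?_ ?_
      · intro γ h
        obtain ⟨δ, h1, -⟩ := h ⟨γ.1, γ.2.1, γ.2⟩ ⟨rfl, rfl, rfl⟩
        exact ⟨γ.2, h1, rfl⟩
      · rintro ⟨x, γ⟩ ⟨x', γ'⟩ _ ⟨h, rfl⟩ ⟨h', e⟩
        obtain rfl : γ' = γ := e
        obtain rfl : x = γ'.1 := h
        obtain rfl : x' = γ'.1 := h'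
        exact ⟨⟨γ'.1, γ'.1, γ'⟩, ⟨γ'.1, γ'.1, γ'⟩, ⟨γ'.1, γ'⟩, ⟨rfl, rfl, rfl⟩, ⟨rfl, rfl, rfl⟩,
          ⟨rfl, rfl⟩, rfl, rfl⟩
    · refine .square (.delta N A) (.delta N A) (S.delta_assoc N A) ?_ ?_
      · intro γ h
        obtain ⟨δ, -, h1, -⟩ := h ⟨γ.1, γ⟩ ⟨rfl, rfl⟩
        exact ⟨γ.2, h1, rfl⟩
      · rintro ⟨x, γ⟩ ⟨x', γ'⟩ _ ⟨h, rfl⟩ ⟨h', e⟩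
        obtain rfl : γ' = γ := e
        obtain rfl : x = γ'.1 := h
        obtain rfl : x' = γ'.1 := h'
        exact ⟨⟨γ'.1, γ'.1, γ'⟩, ⟨γ'.1, γ'.1, γ'⟩, ⟨γ'.1, γ'⟩, ⟨rfl, rfl⟩, ⟨rfl, rfl⟩,
          ⟨rfl, rfl, rfl⟩,
          rfl, rfl, rfl⟩
  | @map _ _ A' k =>
    constructor
    · refine .square (.map M k) (.delta M A') (S.delta_nat M (S.hom k)).symm ?_ ?_
      · intro γ h
        obtain ⟨α, hα⟩ := k.rel_surjective γ.2.2
        obtain ⟨δ, h1, -⟩ := h ⟨γ.1, γ.2.1, α⟩ ⟨rfl, rfl, hα⟩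
        exact ⟨γ.2, h1, rfl⟩
      · rintro ⟨x, γ⟩ ⟨x', γ'⟩ _ ⟨h, rfl⟩ ⟨h', e⟩
        obtain rfl : γ' = γ := e
        obtain rfl : x = γ'.1 := h
        obtain rfl : x' = γ'.1 := h'
        obtain ⟨α, hα⟩ := k.rel_surjective γ'.2
        exact ⟨⟨γ'.1, γ'.1, α⟩, ⟨γ'.1, γ'.1, α⟩, ⟨γ'.1, α⟩, ⟨rfl, rfl, hα⟩, ⟨rfl, rfl, hα⟩,
          ⟨rfl, rfl⟩,
          rfl, rfl⟩
    · refine .square (.delta M A') (.map M k) (S.delta_nat M (S.hom k)) ?_ ?_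
      · intro γ h
        obtain ⟨δ, -, h2⟩ := h ⟨γ.1, γ⟩ ⟨rfl, rfl⟩
        exact ⟨δ.2, h2⟩
      · rintro ⟨x, γ⟩ ⟨x', γ'⟩ ⟨y, ε⟩ ⟨h₁, h⟩ ⟨h₂, h'⟩
        obtain rfl : x = y := h₁
        obtain rfl : x' = x := h₂
        exact ⟨⟨x', x', γ⟩, ⟨x', x', γ'⟩, ⟨x', x', ε⟩, ⟨rfl, rfl⟩, ⟨rfl, rfl⟩, ⟨rfl, rfl, h⟩,
          rfl, rfl, h'⟩

/-- A contraction under the letter `b` against the deletion of this letter. -/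
theorem peak_eps {A B : Modality} (k : Contraction b d A B) :
    S.Peak (.eps A) (.map b k) ∧ S.Peak (.map b k) (.eps A) := by
  constructor
  · refine .square k (.eps B) (S.eps_nat (S.hom k)).symm (fun γ _ => ⟨γ.2, rfl⟩) ?_
    rintro ⟨x, γ⟩ ⟨x', γ'⟩ _ rfl e
    obtain rfl : γ' = γ := e
    obtain ⟨α, hα⟩ := k.rel_surjective γ'
    exact ⟨⟨x, α⟩, ⟨x', α⟩, α, ⟨rfl, hα⟩, ⟨rfl, hα⟩, rfl, rfl⟩
  · refine .square (.eps B) k (S.eps_nat (S.hom k)) (fun γ h => ?_) ?_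
    · obtain ⟨δ, -, h2⟩ := h ⟨True, γ⟩ rfl
      exact ⟨δ.2, h2⟩
    · intro γ γ' ε h h'
      exact ⟨⟨True, γ⟩, ⟨True, γ'⟩, ⟨True, ε⟩, rfl, rfl, ⟨rfl, h⟩, rfl, h'⟩

theorem Peak.map {S : ContractionModel b d C} (M : ModalOp) {A B B' : Modality}
    {k : Contraction b d A B} {k' : Contraction b d A B'} (h : S.Peak k k') :
    S.Peak (.map M k) (.map M k') := by
  cases h with
  | equal h => cases h; exact .equal rfl
  | square j j' comm dom lift =>
    refine .square (.map M j) (.map M j') ?_ ?_ ?_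
    · simp only [hom, ← S.map_comp, comm]
    · intro γ h
      obtain ⟨ε, hε⟩ := dom γ.2 fun α hα =>
        let ⟨δ, hδ⟩ := h ⟨γ.1, α⟩ ⟨rfl, hα⟩
        ⟨δ.2, hδ.2⟩
      exact ⟨⟨γ.1, ε⟩, rfl, hε⟩
    · rintro ⟨x, γ⟩ ⟨x', γ'⟩ ⟨y, ε⟩ ⟨h₁, h⟩ ⟨h₂, h'⟩
      obtain rfl : x = y := h₁
      obtain rfl : x' = x := h₂
      obtain ⟨α, α', δ, h1, h2, h3, h4⟩ := lift γ γ' ε h h'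
      exact ⟨⟨x', α⟩, ⟨x', α'⟩, ⟨x', δ⟩, ⟨rfl, h1⟩, ⟨rfl, h2⟩, ⟨rfl, h3⟩, rfl, h4⟩
  | outside h =>
    refine .outside fun γ => ?_
    obtain ⟨α, h1, h2⟩ := h γ.2
    exact ⟨⟨γ.1, α⟩, ⟨rfl, h1⟩, fun δ hδ => h2 δ.2 hδ.2⟩
  | separated h =>
    refine .separated fun γ => ?_
    obtain ⟨α, α', δ, h1, h2, h3, h4⟩ := h γ.2
    exact ⟨⟨γ.1, α⟩, ⟨γ.1, α'⟩, ⟨γ.1, δ⟩, ⟨rfl, h1⟩, ⟨rfl, h2⟩, ⟨rfl, h3⟩,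
      fun γ' hγ' => h4 γ'.2 hγ'.2⟩

/-- Local confluence of contractions, up to the incompatible pairs. -/
theorem peak (hbd : b ≠ d) {A B B' : Modality} (k : Contraction b d A B)
    (k' : Contraction b d A B')  : S.Peak k k' := by
  induction k generalizing B' with
  | eps A =>
    cases k' with
    | eps => exact .equal rfl
    | delta => exact absurd rfl hbd
    | map _ k' => exact (S.peak_eps k').1
  | delta M A =>
    cases k' with
    | eps => exact absurd rfl hbd
    | delta => exact .equal rfl
    | map _ k' => exact (S.peak_delta k').1
  | map M k ih =>
    cases k' with
    | eps => exact (S.peak_eps k).2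
    | delta => exact (S.peak_delta k).2
    | map _ k' => exact (ih k').map M

/-- A sequence of contractions whose relation factors through that of a contraction `k` can be
rearranged to begin with `k`. -/
theorem exists_extraction (hbd : b ≠ d) {A B Z : Modality} (p : Contractions b d A Z)
    (k : Contraction b d A B) (hk : k.Absorbs p.rel) :
    ∃ q : Contractions b d B Z, S.homs p = S.hom k ≫ S.homs q := by
  induction p generalizing B with
  | nil A =>
    have hR : TotalInjective (Contractions.nil (b := b) (d := d) A).rel :=
      ⟨fun α => ⟨α, rfl⟩, fun h h' => Eq.trans h (Eq.symm h')⟩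
    exact absurd hk (hR.not_absorbs k)
  | @cons A B' Z k' p ih =>
    obtain ⟨z⟩ := Labelling.instNonempty Z
    obtain ⟨γ, hγ⟩ := p.rel_surjective z
    cases S.peak hbd k k' with
    | equal h =>
      cases h
      exact ⟨p, rfl⟩
    | square j j' comm dom lift =>
      obtain ⟨q, hq⟩ := ih j' (by
        constructor
        · intro γ x hx
          exact dom γ fun α hα => hk.dom ⟨γ, hα, hx⟩
        · intro γ γ' ε x h h' hx
          obtain ⟨α, α', δ, h1, h2, h3, h4⟩ := lift γ γ' ε h h'
          obtain ⟨γ'', h5, h6⟩ := hk.invariant h3 h4 ⟨γ, h1, hx⟩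
          obtain rfl := k'.rel_functional h2 h5
          exact h6)
      exact ⟨.cons j q, by simp only [homs, hq, ← Category.assoc, comm]⟩
    | outside h =>
      obtain ⟨α, h1, h2⟩ := h γ
      obtain ⟨δ, hδ⟩ := hk.dom ⟨γ, h1, hγ⟩
      exact absurd hδ (h2 δ)
    | separated h =>
      obtain ⟨α, α', δ, h1, h2, h3, h4⟩ := h γ
      obtain ⟨γ', h5, -⟩ := hk.invariant h2 h3 ⟨γ, h1, hγ⟩
      exact absurd h5 (h4 γ')

/-- A sequence of contractions followed by a total injective relation `R` is determined, together
with `R`, by the resulting relation. The intermediate modality is part of what is determined, so the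
conclusion is an equality of dependent pairs. -/
theorem homs_unique (hbd : b ≠ d) {A Z Z' : Modality} {X : Type} (p : Contractions b d A Z)
    (p' : Contractions b d A Z') {R : Labelling Z → X → Prop} {R' : Labelling Z' → X → Prop}
    (hR : TotalInjective R) (hR' : TotalInjective R')
    (h : ∀ α x, (∃ γ, p.rel α γ ∧ R γ x) ↔ ∃ γ, p'.rel α γ ∧ R' γ x) :
    (⟨Z, S.homs p, R⟩ : Σ Z, (S.obj A ⟶ S.obj Z) × (Labelling Z → X → Prop)) =
      ⟨Z', S.homs p', R'⟩ := by
  induction p with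
  | nil A =>
    cases p' with
    | nil =>
      have : R = R' := by
        funext α x
        simpa [Contractions.rel] using h α x
      rw [this]
    | cons k' q' =>
      refine absurd ?_ (hR.not_absorbs k')
      have h' : ∀ α x, R α x ↔ ∃ γ, (Contractions.cons k' q').rel α γ ∧ R' γ x := fun α x => by
        simpa [Contractions.rel] using h α x
      constructor
      · intro α x hx
        obtain ⟨_, ⟨β, hβ, -⟩, -⟩ := (h' α x).1 hx
        exact ⟨β, hβ⟩
      · intro α α' β x hα hα' hx
        obtain ⟨γ, ⟨β', hβ', hγ⟩, hx'⟩ := (h' α x).1 hx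
        obtain rfl := k'.rel_functional hα hβ'
        exact (h' α' x).2 ⟨γ, ⟨β, hα', hγ⟩, hx'⟩
  | @cons A B Z k q ih =>
    -- `R'` can be cancelled, so the composite relation absorbs `k` only if `p'` does
    have hp' : k.Absorbs p'.rel := by
      constructor
      · intro α γ hγ
        obtain ⟨x, hx⟩ := hR'.total γ
        obtain ⟨_, ⟨β, hβ, -⟩, -⟩ := (h α x).2 ⟨γ, hγ, hx⟩
        exact ⟨β, hβ⟩
      · intro α α' β γ hα hα' hγ
        obtain ⟨x, hx⟩ := hR'.total γ
        obtain ⟨δ, ⟨β', hβ', hδ⟩, hx'⟩ := (h α x).2 ⟨γ, hγ, hx⟩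
        obtain rfl := k.rel_functional hα hβ'
        obtain ⟨γ', hγ', hx''⟩ := (h α' x).1 ⟨δ, ⟨β, hα', hδ⟩, hx'⟩
        obtain rfl := hR'.inj hx hx''
        exact hγ'
    obtain ⟨q', hq'⟩ := S.exists_extraction hbd p' k hp'
    have hrel : ∀ α γ, p'.rel α γ ↔ ∃ β, k.rel α β ∧ q'.rel β γ := by
      intro α γ
      rw [← S.Sem_homs, hq', S.Sem_comp]
      simp only [S.Sem_hom, S.Sem_homs]
    have key := ih q' hR (by
      intro β x
      obtain ⟨α, hα⟩ := k.rel_surjective β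
      have := h α x
      simp only [hrel] at this
      constructor
      · rintro ⟨γ, h1, h2⟩
        obtain ⟨γ', ⟨β', h3, h4⟩, h5⟩ := this.1 ⟨γ, ⟨β, hα, h1⟩, h2⟩
        obtain rfl := k.rel_functional hα h3
        exact ⟨γ', h4, h5⟩
      · rintro ⟨γ, h1, h2⟩
        obtain ⟨γ', ⟨β', h3, h4⟩, h5⟩ := this.2 ⟨γ, ⟨β, hα, h1⟩, h2⟩
        obtain rfl := k.rel_functional hα h3
        exact ⟨γ', h4, h5⟩)
    rw [hq']
    exact congrArg (fun s : Σ Z, (S.obj B ⟶ S.obj Z) × (Labelling Z → X → Prop) =>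
      (⟨s.1, S.hom k ≫ s.2.1, s.2.2⟩ : Σ Z, (S.obj A ⟶ S.obj Z) × (Labelling Z → X → Prop))) key

end ContractionModel

/-! ### Contractions and expansions in `S5` -/

/-- `S5` as a model of contractions, which are interpreted by `ε^□` and `δ^{◇M}`. -/
def contractionModel : ContractionModel box dia S5 where
  obj := S5.mk
  map M := mapHom M
  eps A := ofTerm (.epsBox A)
  delta M A := ofTerm (.deltaDia M A)
  map_id := mapHom_id
  map_comp M _ _ _ := mapHom_comp M
  eps_nat f := by
    obtain ⟨f, rfl⟩ := ofTerm_surjective f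
    exact ofTerm_eq (Eqn.epsBox_nat f)
  delta_nat M _ _ f := by
    obtain ⟨f, rfl⟩ := ofTerm_surjective f
    exact ofTerm_eq (Eqn.deltaDia_nat M f)
  delta_assoc M A := ofTerm_eq (Eqn.deltaDia_assoc M A)
  Sem f := Sem f
  Sem_id := Sem_id
  Sem_comp f g := Sem_comp f g
  Sem_map M _ _ f := Sem_mapHom M f
  Sem_eps := Sem_epsBox
  Sem_delta := Sem_deltaDia

/-- The opposite of `S5` as a model of contractions: these are interpreted by `ε^◇` and `δ^{□M}`,
which are expansions in `S5`. -/
def expansionModel : ContractionModel dia box S5ᵒᵖ where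
  obj A := Opposite.op (S5.mk A)
  map M _ _ f := (mapHom M f.unop).op
  eps A := (ofTerm (.epsDia A)).op
  delta M A := (ofTerm (.deltaBox M A)).op
  map_id M A := congrArg Quiver.Hom.op (mapHom_id M A)
  map_comp M _ _ _ f g := congrArg Quiver.Hom.op (mapHom_comp M g.unop f.unop)
  eps_nat f := by
    obtain ⟨f', hf⟩ := ofTerm_surjective f.unop
    exact (congrArg (fun h => ((ofTerm (.epsDia _)) ≫ mapHom dia h).op) hf.symm).trans
      ((congrArg Quiver.Hom.op (ofTerm_eq (Eqn.epsDia_nat f'))).trans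
        (congrArg (fun h => (h ≫ ofTerm (.epsDia _)).op) hf))
  delta_nat M _ _ f := by
    obtain ⟨f', hf⟩ := ofTerm_surjective f.unop
    exact (congrArg (fun h => (ofTerm (.deltaBox M _) ≫ mapHom box (mapHom M h)).op)
      hf.symm).trans
      ((congrArg Quiver.Hom.op (ofTerm_eq (Eqn.deltaBox_nat M f'))).trans
        (congrArg (fun h => (mapHom M h ≫ ofTerm (.deltaBox M _)).op) hf))
  delta_assoc M A := congrArg Quiver.Hom.op (ofTerm_eq (Eqn.deltaBox_assoc M A))
  Sem f α β := Sem f.unop β α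
  Sem_id α β := (Sem_id β α).trans eq_comm
  Sem_comp f g α γ := (Sem_comp g.unop f.unop γ α).trans (exists_congr fun _ => and_comm)
  Sem_map M _ _ f α β := (Sem_mapHom M f.unop β α).trans (and_congr_left' eq_comm)
  Sem_eps α β := Sem_epsDia β α
  Sem_delta α β := Sem_deltaBox β α

/-- The arrow of a contraction. -/
abbrev contract {A B : Modality} (k : Contraction box dia A B) : S5.mk A ⟶ S5.mk B :=
  contractionModel.hom k

/-- The arrow of an expansion, that is, of a contraction read backwards. -/
abbrev expand {A B : Modality} (e : Contraction dia box B A) : S5.mk A ⟶ S5.mk B :=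
  (expansionModel.hom e).unop

/-- The arrow of a sequence of contractions. -/
abbrev contracts {A B : Modality} (p : Contractions box dia A B) : S5.mk A ⟶ S5.mk B :=
  contractionModel.homs p

/-- The arrow of a sequence of expansions. -/
abbrev expands {A B : Modality} (u : Contractions dia box B A) : S5.mk A ⟶ S5.mk B :=
  (expansionModel.homs u).unop

theorem expands_cons {A B C : Modality} (e : Contraction dia box C B)
    (u : Contractions dia box B A) : expands (.cons e u) = expands u ≫ expand e := rfl

theorem expands_append {A B C : Modality} (u : Contractions dia box B A)
    (v : Contractions dia box C B) : expands (v.append u) = expands u ≫ expands v :=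
  congrArg Quiver.Hom.unop (expansionModel.homs_append v u)

theorem expands_map (M : ModalOp) {A B : Modality} (u : Contractions dia box B A) :
    expands (u.map M) = mapHom M (expands u) :=
  congrArg Quiver.Hom.unop (expansionModel.homs_map M u)

/-! ### Normal forms -/

/-- An expansion followed by a contraction: the two cancel, or can be exchanged. The cancellations
are the `β` and `η` equations; the exchanges are naturality and the Frobenius-like equations. -/
inductive Switch {A B : Modality} (e : Contraction dia box B A) :
    ∀ {C : Modality}, Contraction box dia B C → Prop
  | cancel {k : Contraction box dia B A} (eq : expand e ≫ contract k = 𝟙 (S5.mk A)) : Switch e k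
  | exchange {C D : Modality} {k : Contraction box dia B C} (k' : Contraction box dia A D)
      (e' : Contraction dia box C D) (eq : expand e ≫ contract k = contract k' ≫ expand e') :
      Switch e k

theorem Switch.map (M : ModalOp) {A B C : Modality} {e : Contraction dia box B A}
    {k : Contraction box dia B C} (h : Switch e k) : Switch (.map M e) (.map M k) := by
  have key : expand (.map M e) ≫ contract (.map M k) = mapHom M (expand e ≫ contract k) :=
    (mapHom_comp M _ _).symm
  cases h with
  | cancel eq => exact .cancel (key.trans ((congrArg (mapHom M) eq).trans (mapHom_id M A)))
  | exchange k' e' eq =>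
    exact .exchange (.map M k') (.map M e')
      (key.trans ((congrArg (mapHom M) eq).trans (mapHom_comp M _ _)))

theorem switch {A B C : Modality} (e : Contraction dia box B A) (k : Contraction box dia B C) :
    Switch e k := by
  induction e generalizing C with
  | eps A =>
    cases k with
    | delta M A => exact .cancel (ofTerm_eq (Eqn.dia_beta M A))
    | map _ k =>
      refine .exchange k (.eps _) ?_
      obtain ⟨t, ht⟩ := ofTerm_surjective (contract k)
      change ofTerm (.epsDia _) ≫ mapHom dia (contract k) = contract k ≫ ofTerm (.epsDia _)
      rw [← ht]
      exact ofTerm_eq (Eqn.epsDia_nat t)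
  | delta M A =>
    cases k with
    | eps => exact .cancel (ofTerm_eq (Eqn.box_beta M A))
    | map _ k =>
      cases k with
      | eps => exact .cancel (ofTerm_eq (Eqn.box_eta A))
      | delta N A => exact .exchange (.delta N A) (.delta N A) (ofTerm_eq (Eqn.delta_N N A))
      | @map _ _ A' k =>
        refine .exchange (.map M k) (.delta M A') ?_
        obtain ⟨t, ht⟩ := ofTerm_surjective (contract k)
        change ofTerm (.deltaBox M _) ≫ mapHom box (mapHom M (contract k)) =
          mapHom M (contract k) ≫ ofTerm (.deltaBox M _)
        rw [← ht]
        exact ofTerm_eq (Eqn.deltaBox_nat M t)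
  | @map M B₁ A₁ e ih =>
    cases k with
    | eps =>
      refine .exchange (.eps _) e ?_
      obtain ⟨t, ht⟩ := ofTerm_surjective (expand e)
      change mapHom box (expand e) ≫ ofTerm (.epsBox _) = ofTerm (.epsBox _) ≫ expand e
      rw [← ht]
      exact ofTerm_eq (Eqn.epsBox_nat t)
    | delta N _ =>
      cases e with
      | eps => exact .cancel (ofTerm_eq (Eqn.dia_eta _))
      | delta N A => exact .exchange (.delta N A) (.delta N A) (ofTerm_eq (Eqn.delta_I N A))
      | @map _ _ A₂ e =>
        refine .exchange (.delta N A₂) (.map N e) ?_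
        obtain ⟨t, ht⟩ := ofTerm_surjective (expand e)
        change mapHom dia (mapHom N (expand e)) ≫ ofTerm (.deltaDia N _) =
          ofTerm (.deltaDia N _) ≫ mapHom N (expand e)
        rw [← ht]
        exact ofTerm_eq (Eqn.deltaDia_nat N t)
    | map _ k => exact (ih k).map M

/-- An arrow is normal if it is a sequence of contractions followed by a sequence of expansions. -/
def Normal {A B : Modality} (f : S5.mk A ⟶ S5.mk B) : Prop :=
  ∃ (Z : Modality) (p : Contractions box dia A Z) (u : Contractions dia box B Z),
    f = contracts p ≫ expands u

theorem normal_expands {A B : Modality} (u : Contractions dia box B A) : Normal (expands u) :=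
  ⟨A, .nil A, u, (Category.id_comp _).symm⟩

theorem normal_expand {A B : Modality} (e : Contraction dia box B A) : Normal (expand e) := by
  simpa [expands, ContractionModel.homs] using normal_expands (.cons e (.nil A))

theorem normal_contracts {A B : Modality} (p : Contractions box dia A B) : Normal (contracts p) :=
  ⟨B, p, .nil B, (Category.comp_id _).symm⟩

theorem normal_contract {A B : Modality} (k : Contraction box dia A B) : Normal (contract k) := by
  simpa [contracts, ContractionModel.homs] using normal_contracts (.cons k (.nil B))

theorem Normal.contracts_comp {A B C : Modality} {f : S5.mk B ⟶ S5.mk C} (hf : Normal f)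
    (p : Contractions box dia A B) : Normal (contracts p ≫ f) := by
  obtain ⟨Z, q, u, rfl⟩ := hf
  exact ⟨Z, p.append q, u, by
    rw [← Category.assoc]
    exact congrArg (· ≫ expands u) (contractionModel.homs_append p q).symm⟩

theorem Normal.comp_expands {A B C : Modality} {f : S5.mk A ⟶ S5.mk B} (hf : Normal f)
    (u : Contractions dia box C B) : Normal (f ≫ expands u) := by
  obtain ⟨Z, q, v, rfl⟩ := hf
  exact ⟨Z, q, u.append v, by rw [expands_append, Category.assoc]⟩

/-- A contraction can be moved in front of a sequence of expansions. -/
theorem normal_expands_contract {A B C : Modality} (u : Contractions dia box B A)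
    (k : Contraction box dia B C) : Normal (expands u ≫ contract k) := by
  induction u generalizing C with
  | nil B => exact (Category.id_comp (contract k)).symm ▸ normal_contract k
  | cons e u ih =>
    rw [expands_cons, Category.assoc]
    cases switch e k with
    | cancel eq =>
      rw [eq, Category.comp_id]
      exact normal_expands u
    | exchange k' e' eq =>
      rw [eq, ← Category.assoc]
      simpa [expands, ContractionModel.homs] using (ih k').comp_expands (.cons e' (.nil _))

theorem normal_expands_contracts {A B C : Modality} (u : Contractions dia box B A)
    (p : Contractions box dia B C) : Normal (expands u ≫ contracts p) := by
  induction p generalizing A with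
  | nil B => exact (Category.comp_id (expands u)).symm ▸ normal_expands u
  | cons k p ih =>
    obtain ⟨Z, q, v, h⟩ := normal_expands_contract u k
    have : expands u ≫ contracts (.cons k p) = contracts q ≫ expands v ≫ contracts p := by
      rw [← Category.assoc (contracts q), ← h, Category.assoc]
      rfl
    rw [this]
    exact (ih v).contracts_comp q

theorem Normal.comp {A B C : Modality} {f : S5.mk A ⟶ S5.mk B} {g : S5.mk B ⟶ S5.mk C}
    (hf : Normal f) (hg : Normal g) : Normal (f ≫ g) := by
  obtain ⟨Z, p, u, rfl⟩ := hf
  obtain ⟨Z', q, v, rfl⟩ := hg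
  have := ((normal_expands_contracts u q).contracts_comp p).comp_expands v
  simpa only [Category.assoc] using this

theorem Normal.mapHom (M : ModalOp) {A B : Modality} {f : S5.mk A ⟶ S5.mk B} (hf : Normal f) :
    Normal (mapHom M f) := by
  obtain ⟨Z, p, u, rfl⟩ := hf
  refine ⟨_, p.map M, u.map M, ?_⟩
  rw [mapHom_comp, expands_map]
  exact congrArg (· ≫ S5.mapHom M (expands u)) (contractionModel.homs_map M p).symm

theorem normal {A B : Modality} (f : S5.mk A ⟶ S5.mk B) : Normal f := by
  obtain ⟨t, rfl⟩ := ofTerm_surjective f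
  induction t with
  | one A => exact normal_contracts (.nil A)
  | epsBox A => exact normal_contract (.eps A)
  | deltaDia M A => exact normal_contract (.delta M A)
  | epsDia A => exact normal_expand (.eps A)
  | deltaBox M A => exact normal_expand (.delta M A)
  | comp g f hg hf => exact hf.comp hg
  | map M f hf => exact hf.mapHom M

/-- The relation of a sequence of expansions: the converse of a surjective partial function. -/
theorem totalInjective_expansions {A B : Modality} (u : Contractions dia box B A) :
    TotalInjective fun α β => u.rel β α :=
  ⟨u.rel_surjective, fun h h' => u.rel_functional h h'⟩

theorem Sem_normal {A B Z : Modality} (p : Contractions box dia A Z)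
    (u : Contractions dia box B Z) (α : Labelling A) (β : Labelling B) :
    Sem (contracts p ≫ expands u) α β ↔ ∃ γ, p.rel α γ ∧ u.rel β γ :=
  (Sem_comp _ _ α β).trans (exists_congr fun γ =>
    and_congr (contractionModel.Sem_homs p α γ) (expansionModel.Sem_homs u β γ))

theorem eq_of_Sem {A B : Modality} {f g : S5.mk A ⟶ S5.mk B}
    (h : ∀ α β, Sem f α β ↔ Sem g α β) : f = g := by
  obtain ⟨Z, p, u, rfl⟩ := normal f
  obtain ⟨Z', p', u', rfl⟩ := normal g
  simp only [Sem_normal] at h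
  have hp := contractionModel.homs_unique (by simp) p p' (totalInjective_expansions u)
    (totalInjective_expansions u') h
  obtain rfl : Z = Z' := congrArg Sigma.fst hp
  obtain ⟨hp, hu⟩ := Prod.ext_iff.1 (eq_of_heq (Sigma.mk.inj hp).2)
  -- the sequences of expansions now have the same relation, and are compared as contractions in the
  -- opposite category
  have hEq : ∀ {X : Type}, TotalInjective (Eq : X → X → Prop) :=
    ⟨fun x => ⟨x, rfl⟩, fun h h' => h.trans h'.symm⟩
  have hu' := expansionModel.homs_unique (by simp) u u' (R := Eq) (R' := Eq) hEq hEq (by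
    intro β γ
    simpa using iff_of_eq (congrFun (congrFun hu γ) β))
  obtain ⟨hu', -⟩ := Prod.ext_iff.1 (eq_of_heq (Sigma.mk.inj hu').2)
  exact congrArg₂ (fun x y => x ≫ Quiver.Hom.unop y) hp hu'

end S5

theorem mainTheorem1 : S5.G.Faithful := by
  constructor
  rintro ⟨A⟩ ⟨B⟩ f g h
  exact S5.eq_of_Sem fun α β => by simp only [S5.Sem, h]
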